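/- Let $n$ be a number of boxes with opening costs $c_i \ge 0$ and volumes $v_i \ge 0$ ($i \in [n]$), the volumes being those of an arbitrary fixed scenario, and let $\beta_i = c_i + v_i$ be the balanced time of box $i$. For a random process of box arrivals on the time axis $(0,\infty)$, let $\alpha_i \in [0,\infty]$ be the first arrival time of box $i$ (the infimum of its arrival times, $\infty$ if there are none), and let $$\tau_i = \max\{\alpha_i, \beta_i\}, \qquad \tau^* = \min_{i \in [n]} \tau_i, \qquad i^* \in \operatorname*{arg\,min}_{i \in [n]} \tau_i,$$ so that Balanced Stopping stops at time $\tau^*$ and takes box $i^*$ (ties are broken in an arbitrary measurable way). Its objective bound is $\tau^* + c_{i^*} + v_{i^*} = \tau^* + \beta_{i^*}$, which is $\infty$ if $\tau^* = \infty$. Consider a good and a bad process of box arrivals, independent of each other. In the good process, box $i$ arrives according to a non-homogeneous Poisson process on $(0,\infty)$ with measurable rate $\lambda_i^g(\tau) \in [0,\infty)$, independently for the different boxes; in the bad process, box $i$ arrives according to a non-homogeneous Poisson process on $(0,\infty)$ with measurable rate $\lambda_i^b(\tau) \in [0,\infty)$, again independently for the different boxes. The bad rates are arbitrary; of the good rates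 suppose that $$\sum_{i \in [n]} \lambda_i^g(\tau) \le \frac{2}{\tau} \qquad \text{for all } \tau > 0 .$$ Then the expectation of $\tau^* + \beta_{i^*}$ when both the good and the bad arrivals are present (the arrivals of each box are the union of its good and its bad arrivals) is at most the expectation of $\tau^* + \beta_{i^*}$ when only the good arrivals are present. Both expectations are taken in $[0,\infty]$. -/

import Mathlib

open MeasureTheory ProbabilityTheory Set
open scoped NNReal ENNReal

/-! A random set of arrival times is a map `A : Ω → Set ℝ`; a family of them, one for each
box `i : Fin n`, is a map `A : Fin n → Ω → Set ℝ`. -/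

namespace BalancedStopping

noncomputable section

/-- The number of arrivals of the random point set `A` in the set `B` of times. -/
def count {Ω : Type*} (A : Ω → Set ℝ) (B : Set ℝ) (ω : Ω) : ℕ∞ :=
  (A ω ∩ B).encard

/-- The σ-algebra generated by a random point set, that is, by its counts on all Borel sets. -/
@[reducible] def sigmaAlg {Ω : Type*} (A : Ω → Set ℝ) : MeasurableSpace Ω :=
  ⨆ B : {B : Set ℝ // MeasurableSet B}, MeasurableSpace.comap (count A B.1) inferInstance

/-- The σ-algebra generated by the arrivals of all boxes. -/
@[reducible] def sigmaAlgFamily {Ω : Type*} {n : ℕ} (A : Fin n → Ω → Set ℝ) : MeasurableSpace Ω :=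
  ⨆ i, sigmaAlg (A i)

/-- The expected number `∫_B r(τ) dτ` of arrivals in `B ∩ (0, ∞)` at rate `r`. -/
def mass (r : ℝ → ℝ≥0) (B : Set ℝ) : ℝ≥0∞ :=
  ∫⁻ τ in B ∩ Ioi 0, (r τ : ℝ≥0∞)

/-- `A` is a (non-homogeneous) Poisson process on `(0, ∞)` with arrival rate `r`: the number of
arrivals in a Borel set is Poisson distributed with mean the integral of the rate (and almost
surely infinite if this integral is infinite), and the numbers of arrivals in disjoint Borel
sets are independent. -/
structure IsPoissonProcess {Ω : Type*} [MeasurableSpace Ω] (P : Measure Ω)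
    (A : Ω → Set ℝ) (r : ℝ → ℝ≥0) : Prop where
  pos : ∀ ω, A ω ⊆ Ioi 0
  measurable_count : ∀ B, MeasurableSet B → Measurable (count A B)
  law : ∀ B, MeasurableSet B → mass r B ≠ ∞ →
    P.map (count A B) = (poissonMeasure (mass r B).toNNReal).map (fun k : ℕ => (k : ℕ∞))
  law_top : ∀ B, MeasurableSet B → mass r B = ∞ → ∀ᵐ ω ∂P, count A B ω = ⊤
  indep : ∀ (m : ℕ) (B : Fin m → Set ℝ), (∀ j, MeasurableSet (B j)) →
    (∀ j k, j ≠ k → Disjoint (B j) (B k)) → iIndepFun (fun j => count A (B j)) P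

/-- A Poisson process of box arrivals: box `i` arrives according to a Poisson process with rate
`r i`, independently for the different boxes. -/
structure IsPoissonArrivals {Ω : Type*} [MeasurableSpace Ω] {n : ℕ} (P : Measure Ω)
    (A : Fin n → Ω → Set ℝ) (r : Fin n → ℝ → ℝ≥0) : Prop where
  poisson : ∀ i, IsPoissonProcess P (A i) (r i)
  indep : iIndep (fun i => sigmaAlg (A i)) P

/-- The superposition of two families of arrivals. -/
def superpose {Ω : Type*} {n : ℕ} (A B : Fin n → Ω → Set ℝ) : Fin n → Ω → Set ℝ :=
  fun i ω => A i ω ∪ B i ω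

/-- The arrival time `α_i`: the infimum of the arrivals of box `i`, `∞` if there is none. -/
def arrivalTime {Ω : Type*} {n : ℕ} (A : Fin n → Ω → Set ℝ) (i : Fin n) (ω : Ω) : ℝ≥0∞ :=
  ⨅ τ ∈ A i ω, ENNReal.ofReal τ

/-- The balanced time `β_i = c_i + v_i`. -/
def balancedTime {n : ℕ} (c v : Fin n → ℝ≥0) (i : Fin n) : ℝ≥0 :=
  c i + v i

/-- `τ_i = max {α_i, β_i}`, the earliest time at which box `i` can be taken. -/
def takeTime {Ω : Type*} {n : ℕ} (c v : Fin n → ℝ≥0) (A : Fin n → Ω → Set ℝ)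
    (i : Fin n) (ω : Ω) : ℝ≥0∞ :=
  max (arrivalTime A i ω) (balancedTime c v i)

/-- The stopping time `τ* = min_i τ_i` of Balanced Stopping. -/
def stoppingTime {Ω : Type*} {n : ℕ} (c v : Fin n → ℝ≥0) (A : Fin n → Ω → Set ℝ)
    (ω : Ω) : ℝ≥0∞ :=
  ⨅ i, takeTime c v A i ω

/-- `I` is the box `i* = argmin_i τ_i` taken by Balanced Stopping, under some measurable way of
breaking ties. -/
structure IsTakenBox {Ω : Type*} [MeasurableSpace Ω] {n : ℕ} (c v : Fin n → ℝ≥0)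
    (A : Fin n → Ω → Set ℝ) (I : Ω → Fin n) : Prop where
  measurable : Measurable I
  argmin : ∀ ω, takeTime c v A (I ω) ω = stoppingTime c v A ω

/-- The objective bound `τ* + c_{i*} + v_{i*} = τ* + β_{i*}` of Balanced Stopping that takes the
box `I ω`; it is `∞` if no box is ever taken. -/
def objective {Ω : Type*} {n : ℕ} (c v : Fin n → ℝ≥0) (A : Fin n → Ω → Set ℝ)
    (I : Ω → Fin n) (ω : Ω) : ℝ≥0∞ :=
  stoppingTime c v A ω + balancedTime c v (I ω)

end

end BalancedStopping

/-! Write T and U for the stopping times under the good and under the bad arrivals alone, and M for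
the smallest good objective over all tie-breakings. With both processes present the stopping time is
min(T, U). If U ≤ T, the objective is at most 2U, because the balanced time of the taken box never
exceeds the stopping time. If T < U, the box taken is also a minimiser for the good process, and
ties are almost surely harmless (`ae_balancedTime_eq`), so the objective is at most M. It remains to
see that E[2U; U ≤ T] ≤ E[M; U ≤ T]. As U is independent of (T, M), it can be frozen at a value x
(`lintegral_indicator_le_of_indepFun`).

The heart is thus `two_mul_le_setLIntegral_minObjective`: given T ≥ x, the good objective has mean
at least 2x. For x = t in (0, ∞), fix the set J of boxes that arrived before t. Then T ≥ t forces
every balanced time in J to be at least t; let d be the least of them and S the first arrival from t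
on. The objective is at least min(S, d), plus d if S > d. The rate bound 2/τ gives P(S > u) ≥ (t/u)²
for u ≥ t, independently of J, so the mean is at least t + ∫_t^d (t/u)² du + d(t/d)² = t + (t -
t²/d) + t²/d = 2t. -/

namespace BalancedStopping

/-! ### Counts, arrival times and their measurability -/

variable {Ω : Type*} {n : ℕ}

theorem count_eq_zero_iff {A : Ω → Set ℝ} {B : Set ℝ} {ω : Ω} :
    count A B ω = 0 ↔ ∀ τ ∈ A ω, τ ∉ B := by
  simp only [count, encard_eq_zero, eq_empty_iff_forall_notMem, mem_inter_iff, not_and]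

theorem ofReal_le_arrivalTime_iff {A : Fin n → Ω → Set ℝ} {i : Fin n} {ω : Ω} {s : ℝ}
    (hs : 0 < s) :
    ENNReal.ofReal s ≤ arrivalTime A i ω ↔ count (A i) (Iio s) ω = 0 := by
  simp only [arrivalTime, le_iInf_iff, count_eq_zero_iff, mem_Iio, not_lt]
  refine forall₂_congr fun τ _ => ⟨fun h => ?_, ENNReal.ofReal_le_ofReal⟩
  by_contra! hlt
  exact absurd h (not_le.2 ((ENNReal.ofReal_lt_ofReal_iff hs).2 hlt))

/-- The σ-algebra is left free because the independence arguments need measurability with respect to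
`sigmaAlg` and `sigmaAlgFamily`, not only the ambient one. -/
theorem measurable_arrivalTime {m : MeasurableSpace Ω} {A : Fin n → Ω → Set ℝ} {i : Fin n}
    (h : ∀ B, MeasurableSet B → Measurable (count (A i) B)) :
    Measurable (arrivalTime A i) := by
  refine measurable_of_Ici fun x => ?_
  have key : ∀ B, MeasurableSet B → MeasurableSet {ω | count (A i) B ω = 0} := fun B hB =>
    h B hB (measurableSet_singleton 0)
  rcases eq_or_ne x 0 with rfl | h0
  · simp
  rcases eq_or_ne x ∞ with rfl | htop
  · convert key univ MeasurableSet.univ using 1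
    ext ω
    simp [count_eq_zero_iff, arrivalTime]
  · convert key (Iio x.toReal) measurableSet_Iio using 1
    ext ω
    rw [mem_ofPred_eq, ← ofReal_le_arrivalTime_iff (ENNReal.toReal_pos h0 htop),
      ENNReal.ofReal_toReal htop]
    rfl

theorem measurable_count_sigmaAlg (A : Ω → Set ℝ) {B : Set ℝ} (hB : MeasurableSet B) :
    Measurable[sigmaAlg A] (count A B) := by
  have h : MeasurableSpace.comap (count A B) inferInstance ≤ sigmaAlg A :=
    le_iSup (fun B : {B : Set ℝ // MeasurableSet B} =>
      MeasurableSpace.comap (count A B.1) inferInstance) ⟨B, hB⟩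
  exact fun s hs => h _ ⟨s, hs, rfl⟩

theorem measurable_count_sigmaAlgFamily (A : Fin n → Ω → Set ℝ) (i : Fin n) {B : Set ℝ}
    (hB : MeasurableSet B) : Measurable[sigmaAlgFamily A] (count (A i) B) :=
  fun _ hs => le_iSup (fun i => sigmaAlg (A i)) i _ (measurable_count_sigmaAlg (A i) hB hs)

/-! ### Void probabilities under the rate bound -/

section Poisson

variable [MeasurableSpace Ω] {P : Measure Ω}

theorem IsPoissonProcess.measure_count_eq_zero {A : Ω → Set ℝ} {r : ℝ → ℝ≥0}
    (h : IsPoissonProcess P A r) {B : Set ℝ} (hB : MeasurableSet B) (hm : mass r B ≠ ∞) :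
    P {ω | count A B ω = 0} = ENNReal.ofReal (Real.exp (-(mass r B).toReal)) := by
  have h1 : P {ω | count A B ω = 0} = P.map (count A B) {0} := by
    rw [Measure.map_apply (h.measurable_count B hB) (measurableSet_singleton 0)]
    rfl
  have h2 : (fun k : ℕ => (k : ℕ∞)) ⁻¹' {0} = {0} := by
    ext k
    simp
  rw [h1, h.law B hB hm, Measure.map_apply measurable_from_nat (measurableSet_singleton 0), h2,
    poissonMeasure_singleton]
  simp [ENNReal.coe_toNNReal_eq_toReal]

/-- The numbers of arrivals in two disjoint sets are independent. -/
theorem IsPoissonProcess.indepFun_count {A : Ω → Set ℝ} {r : ℝ → ℝ≥0}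
    (h : IsPoissonProcess P A r) {B C : Set ℝ} (hB : MeasurableSet B) (hC : MeasurableSet C)
    (hBC : Disjoint B C) : IndepFun (count A B) (count A C) P := by
  have := h.indep 2 ![B, C] (by simp [Fin.forall_fin_two, hB, hC])
    (by simp [Fin.forall_fin_two, hBC, hBC.symm])
  simpa using this.indepFun (i := 0) (j := 1) (by simp)

theorem sum_mass_Ico_le {r : Fin n → ℝ → ℝ≥0} (hr : ∀ i, Measurable (r i))
    (hbound : ∀ τ : ℝ, 0 < τ → ∑ i, (r i τ : ℝ) ≤ 2 / τ) {t s : ℝ} (ht : 0 < t) (hts : t ≤ s) :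
    ∑ i, mass (r i) (Ico t s) ≤ ENNReal.ofReal (2 * Real.log (s / t)) := by
  have hsub : Ico t s ∩ Ioi 0 = Ico t s := inter_eq_left.2 fun x hx => ht.trans_le hx.1
  have hint : IntervalIntegrable (fun τ : ℝ => 2 * τ⁻¹) volume t s :=
    (intervalIntegral.intervalIntegrable_inv (f := fun x => x)
      (fun x hx => by rw [uIcc_of_le hts] at hx; exact (ht.trans_le hx.1).ne')
      continuousOn_id).const_mul 2
  have hval : ∫ τ in t..s, 2 * τ⁻¹ = 2 * Real.log (s / t) := by
    rw [intervalIntegral.integral_const_mul, integral_inv_of_pos ht (ht.trans_le hts)]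
  rw [← hval, intervalIntegral.integral_of_le hts, ofReal_integral_eq_lintegral_ofReal hint.1,
    ← restrict_Ico_eq_restrict_Ioc]
  · simp only [mass, hsub]
    rw [← lintegral_finsetSum _ fun i _ => (hr i).coe_nnreal_ennreal]
    refine setLIntegral_mono (by fun_prop) fun τ hτ => ?_
    have := hbound τ (ht.trans_le hτ.1)
    rw [div_eq_mul_inv] at this
    refine le_trans (le_of_eq ?_) (ENNReal.ofReal_le_ofReal this)
    rw [← NNReal.coe_sum, ENNReal.ofReal_coe_nnreal]
    simp
  · refine (ae_restrict_iff' measurableSet_Ioc).2 (ae_of_all _ fun τ hτ => ?_)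
    have := ht.trans hτ.1
    simp only [Pi.zero_apply]
    positivity

theorem mass_Ico_ne_top {r : Fin n → ℝ → ℝ≥0} (hr : ∀ i, Measurable (r i))
    (hbound : ∀ τ : ℝ, 0 < τ → ∑ i, (r i τ : ℝ) ≤ 2 / τ) {t s : ℝ} (ht : 0 < t) (hts : t ≤ s)
    (i : Fin n) : mass (r i) (Ico t s) ≠ ∞ :=
  ne_top_of_le_ne_top ENNReal.ofReal_ne_top
    ((Finset.single_le_sum (f := fun i => mass (r i) (Ico t s)) (fun _ _ => zero_le)
      (Finset.mem_univ i)).trans (sum_mass_Ico_le hr hbound ht hts))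

/-- The product is exp of minus the total mass, and integrating 2/τ bounds that mass by 2 log(s/t);
the exponent 2 is the constant of the rate bound. -/
theorem IsPoissonArrivals.le_prod_measure_count_Ico {A : Fin n → Ω → Set ℝ}
    {r : Fin n → ℝ → ℝ≥0} (h : IsPoissonArrivals P A r) (hr : ∀ i, Measurable (r i))
    (hbound : ∀ τ : ℝ, 0 < τ → ∑ i, (r i τ : ℝ) ≤ 2 / τ) {t s : ℝ} (ht : 0 < t) (hts : t ≤ s) :
    ENNReal.ofReal ((t / s) ^ 2) ≤ ∏ i, P {ω | count (A i) (Ico t s) ω = 0} := by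
  have hm := mass_Ico_ne_top hr hbound ht hts
  have hs := ht.trans_le hts
  simp_rw [fun i => (h.poisson i).measure_count_eq_zero measurableSet_Ico (hm i)]
  rw [← ENNReal.ofReal_prod_of_nonneg fun i _ => (Real.exp_pos _).le, ← Real.exp_sum]
  refine ENNReal.ofReal_le_ofReal ?_
  rw [← Real.log_le_iff_le_exp (by positivity), Finset.sum_neg_distrib,
    ← ENNReal.toReal_sum fun i _ => hm i, Real.log_pow, Nat.cast_ofNat, ← inv_div, Real.log_inv]
  have := ENNReal.toReal_le_of_le_ofReal
    (mul_nonneg zero_le_two (Real.log_nonneg ((one_le_div ht).2 hts)))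
    (sum_mass_Ico_le hr hbound ht hts)
  linarith

/-- An arrival time has no atoms in `(0, ∞)`. -/
theorem IsPoissonArrivals.measure_arrivalTime_eq [IsProbabilityMeasure P]
    {A : Fin n → Ω → Set ℝ}
    {r : Fin n → ℝ → ℝ≥0} (h : IsPoissonArrivals P A r) (hr : ∀ i, Measurable (r i))
    (hbound : ∀ τ : ℝ, 0 < τ → ∑ i, (r i τ : ℝ) ≤ 2 / τ) {x : ℝ≥0∞} (h0 : x ≠ 0) (hx : x ≠ ∞)
    (i : Fin n) : P {ω | arrivalTime A i ω = x} = 0 := by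
  obtain ⟨s, hs, rfl⟩ : ∃ s : ℝ, 0 < s ∧ x = ENNReal.ofReal s :=
    ⟨x.toReal, ENNReal.toReal_pos h0 hx, (ENNReal.ofReal_toReal hx).symm⟩
  -- A first arrival exactly at s puts an arrival in [s, u), which becomes unlikely as u decreases
  -- to s.
  have hle : ∀ u, s < u → P {ω | arrivalTime A i ω = ENNReal.ofReal s} ≤
      1 - ENNReal.ofReal ((s / u) ^ 2) := by
    intro u hu
    have hsub : {ω | arrivalTime A i ω = ENNReal.ofReal s} ⊆
        {ω | count (A i) (Ico s u) ω = 0}ᶜ := by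
      intro ω hω hc
      simp only [mem_ofPred_eq] at hω hc
      have h1 := (ofReal_le_arrivalTime_iff hs).1 hω.ge
      have h2 : ENNReal.ofReal u ≤ arrivalTime A i ω := by
        rw [ofReal_le_arrivalTime_iff (hs.trans hu)]
        rw [count_eq_zero_iff] at *
        intro τ hτ hlt
        rcases lt_or_ge τ s with h | h
        exacts [h1 τ hτ h, hc τ hτ ⟨h, hlt⟩]
      rw [hω] at h2
      exact absurd h2 (not_le.2 ((ENNReal.ofReal_lt_ofReal_iff (hs.trans hu)).2 hu))
    refine (measure_mono hsub).trans ?_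
    rw [prob_compl_eq_one_sub (s := {ω | count (A i) (Ico s u) ω = 0}) ((h.poisson i).measurable_count _ measurableSet_Ico
      (measurableSet_singleton 0))]
    refine tsub_le_tsub_left ((h.le_prod_measure_count_Ico hr hbound hs hu.le).trans ?_) 1
    -- The void probability of box i alone dominates the product over all boxes, whose other factors
    -- are at most 1.
    rw [← Finset.mul_prod_erase _ _ (Finset.mem_univ i)]
    exact mul_le_of_le_one_right' (Finset.prod_le_one' fun _ _ => prob_le_one)
  have hlim : Filter.Tendsto (fun u => 1 - ENNReal.ofReal ((s / u) ^ 2))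
      (nhdsWithin s (Ioi s)) (nhds (1 - ENNReal.ofReal ((s / s) ^ 2))) := by
    refine (ENNReal.Tendsto.sub tendsto_const_nhds ?_ (Or.inl ENNReal.one_ne_top))
    refine ENNReal.tendsto_ofReal (Filter.Tendsto.mono_left ?_ nhdsWithin_le_nhds)
    exact ((tendsto_const_nhds.div Filter.tendsto_id hs.ne').pow 2)
  rw [div_self hs.ne'] at hlim
  simp only [one_pow, ENNReal.ofReal_one, tsub_self] at hlim
  exact le_antisymm (ge_of_tendsto hlim (eventually_nhdsWithin_of_forall hle)) zero_le

end Poisson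

/-- The first arrival of any box at or after time `t`. -/
noncomputable def firstArrivalFrom (A : Fin n → Ω → Set ℝ) (t : ℝ) (ω : Ω) : ℝ≥0∞ :=
  ⨅ i, arrivalTime (fun i ω => A i ω ∩ Ici t) i ω

theorem count_inter (A : Ω → Set ℝ) (B C : Set ℝ) :
    count (fun ω => A ω ∩ C) B = count A (C ∩ B) := by
  funext ω
  simp only [count, inter_assoc]

theorem ofReal_le_firstArrivalFrom_iff {A : Fin n → Ω → Set ℝ} {t s : ℝ} {ω : Ω} (hs : 0 < s) :
    ENNReal.ofReal s ≤ firstArrivalFrom A t ω ↔ ∀ i, count (A i) (Ico t s) ω = 0 := by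
  simp only [firstArrivalFrom, le_iInf_iff, ofReal_le_arrivalTime_iff hs, count_inter,
    Ici_inter_Iio]

/-- The event that exactly the boxes in `J` arrive before time `t`. -/
def arrivedBefore (A : Fin n → Ω → Set ℝ) (t : ℝ) (J : Finset (Fin n)) : Set Ω :=
  ⋂ i, {ω | count (A i) (Iio t) ω ≠ 0 ↔ i ∈ J}

/-- The smallest objective bound over all ways of breaking ties. -/
noncomputable def minObjective (c v : Fin n → ℝ≥0) (A : Fin n → Ω → Set ℝ) (ω : Ω) : ℝ≥0∞ :=
  ⨅ i, if takeTime c v A i ω = stoppingTime c v A ω then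
    stoppingTime c v A ω + balancedTime c v i else ∞

theorem minObjective_le (c v : Fin n → ℝ≥0) (A : Fin n → Ω → Set ℝ) {I : Ω → Fin n} {ω : Ω}
    (h : takeTime c v A (I ω) ω = stoppingTime c v A ω) :
    minObjective c v A ω ≤ objective c v A I ω :=
  iInf_le_of_le (I ω) (by rw [if_pos h, objective])

theorem le_minObjective {c v : Fin n → ℝ≥0} {A : Fin n → Ω → Set ℝ} {ω : Ω} {x : ℝ≥0∞}
    (h : ∀ i, takeTime c v A i ω = stoppingTime c v A ω →
      x ≤ stoppingTime c v A ω + balancedTime c v i) :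
    x ≤ minObjective c v A ω := by
  refine le_iInf fun i => ?_
  split_ifs with hi
  exacts [h i hi, le_top]

theorem stoppingTime_le_minObjective (c v : Fin n → ℝ≥0) (A : Fin n → Ω → Set ℝ) (ω : Ω) :
    stoppingTime c v A ω ≤ minObjective c v A ω :=
  le_minObjective fun _ _ => le_self_add

/-! ### Measurability of the stopping rule -/

section Measurability

variable {m : MeasurableSpace Ω} {A : Fin n → Ω → Set ℝ}

theorem measurable_takeTime (c v : Fin n → ℝ≥0)
    (h : ∀ i B, MeasurableSet B → Measurable (count (A i) B)) (i : Fin n) :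
    Measurable (takeTime c v A i) :=
  (measurable_arrivalTime (h i)).max measurable_const

theorem measurable_stoppingTime (c v : Fin n → ℝ≥0)
    (h : ∀ i B, MeasurableSet B → Measurable (count (A i) B)) :
    Measurable (stoppingTime c v A) :=
  Measurable.iInf fun i => measurable_takeTime c v h i

theorem measurable_minObjective (c v : Fin n → ℝ≥0)
    (h : ∀ i B, MeasurableSet B → Measurable (count (A i) B)) :
    Measurable (minObjective c v A) :=
  Measurable.iInf fun i => Measurable.ite
    (measurableSet_eq_fun (measurable_takeTime c v h i) (measurable_stoppingTime c v h))
    ((measurable_stoppingTime c v h).add_const _) measurable_const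

theorem measurable_firstArrivalFrom
    (h : ∀ i B, MeasurableSet B → Measurable (count (A i) B)) (t : ℝ) :
    Measurable (firstArrivalFrom A t) :=
  Measurable.iInf fun i => measurable_arrivalTime fun B hB => by
    rw [count_inter]
    exact h i _ (measurableSet_Ici.inter hB)

theorem measurableSet_count_ne_zero_iff {A : Ω → Set ℝ} {B : Set ℝ}
    (h : Measurable (count A B)) (p : Prop) : MeasurableSet {ω | count A B ω ≠ 0 ↔ p} := by
  by_cases hp : p
  · simp only [hp, iff_true]
    exact (h (measurableSet_singleton 0)).compl
  · simp only [hp, iff_false, not_not]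
    exact h (measurableSet_singleton 0)

theorem measurableSet_arrivedBefore
    (h : ∀ i B, MeasurableSet B → Measurable (count (A i) B)) (t : ℝ) (J : Finset (Fin n)) :
    MeasurableSet (arrivedBefore A t J) :=
  MeasurableSet.iInter fun i => measurableSet_count_ne_zero_iff (h i _ measurableSet_Iio) _

end Measurability

/-! ### Pathwise bounds given the boxes that arrived before t -/

section Deterministic

variable {c v : Fin n → ℝ≥0} {A : Fin n → Ω → Set ℝ} {t : ℝ} {J : Finset (Fin n)} {ω : Ω}

theorem firstArrivalFrom_le_takeTime (hω : ω ∈ arrivedBefore A t J) {i : Fin n} (hi : i ∉ J) :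
    firstArrivalFrom A t ω ≤ takeTime c v A i ω := by
  have h0 : count (A i) (Iio t) ω = 0 := not_ne_iff.1 fun h => hi ((mem_iInter.1 hω i).1 h)
  rw [count_eq_zero_iff] at h0
  refine (iInf_le _ i).trans (le_trans ?_ (le_max_left _ _))
  exact le_iInf₂ fun τ hτ => iInf₂_le τ ⟨hτ, mem_Ici.2 (not_lt.1 (h0 τ hτ))⟩

theorem arrivalTime_lt_of_mem (ht : 0 < t) (hω : ω ∈ arrivedBefore A t J) {i : Fin n}
    (hi : i ∈ J) : arrivalTime A i ω < ENNReal.ofReal t := by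
  rw [← not_le, ofReal_le_arrivalTime_iff ht]
  exact (mem_iInter.1 hω i).2 hi

theorem min_firstArrivalFrom_le_stoppingTime (hω : ω ∈ arrivedBefore A t J) {d : ℝ≥0∞}
    (hd : ∀ i ∈ J, d ≤ balancedTime c v i) :
    min (firstArrivalFrom A t ω) d ≤ stoppingTime c v A ω := by
  refine le_iInf fun i => ?_
  by_cases hi : i ∈ J
  · exact (min_le_right _ _).trans ((hd i hi).trans (le_max_right _ _))
  · exact (min_le_left _ _).trans (firstArrivalFrom_le_takeTime hω hi)

/-- If the boxes in `J` are those that arrived before `t`, and `d ≥ t` is the first of their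
balanced times, then Balanced Stopping takes a box with balanced time `d` at time `d` unless
another box arrives in between. -/
theorem min_add_indicator_le_minObjective (ht : 0 < t) (hω : ω ∈ arrivedBefore A t J)
    {j : Fin n} (hj : j ∈ J) (htj : ENNReal.ofReal t ≤ balancedTime c v j)
    (hd : ∀ i ∈ J, balancedTime c v j ≤ balancedTime c v i) :
    min (firstArrivalFrom A t ω) (balancedTime c v j) +
      {ω | (balancedTime c v j : ℝ≥0∞) < firstArrivalFrom A t ω}.indicator
        (fun _ => (balancedTime c v j : ℝ≥0∞)) ω ≤ minObjective c v A ω := by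
  have hmin := min_firstArrivalFrom_le_stoppingTime (c := c) (v := v) hω
    (d := balancedTime c v j) fun i hi => by exact_mod_cast hd i hi
  refine le_minObjective fun i hi => ?_
  -- If S > d, Balanced Stopping stops by time d, before any box outside J is available, so every
  -- minimiser lies in J and has balanced time at least d. Otherwise the balanced time is simply
  -- dropped.
  by_cases hS : (balancedTime c v j : ℝ≥0∞) < firstArrivalFrom A t ω
  · have hle : takeTime c v A i ω ≤ balancedTime c v j := by
      rw [hi]
      exact (iInf_le _ j).trans
        (max_le ((arrivalTime_lt_of_mem ht hω hj).le.trans htj) le_rfl)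
    have hiJ : i ∈ J := by
      by_contra hiJ
      exact absurd ((firstArrivalFrom_le_takeTime hω hiJ).trans hle) (not_le.2 hS)
    rw [indicator_of_mem (by exact hS)]
    exact add_le_add hmin (by exact_mod_cast hd i hiJ)
  · rw [indicator_of_notMem (by exact hS), add_zero]
    exact hmin.trans le_self_add

theorem iUnion_arrivedBefore (A : Fin n → Ω → Set ℝ) (t : ℝ) :
    ⋃ J, arrivedBefore A t J = univ := by
  classical
  refine eq_univ_of_forall fun ω => mem_iUnion.2
    ⟨Finset.univ.filter fun i => count (A i) (Iio t) ω ≠ 0, mem_iInter.2 fun i => ?_⟩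
  simp

theorem pairwise_disjoint_arrivedBefore (A : Fin n → Ω → Set ℝ) (t : ℝ) :
    Pairwise (Function.onFun Disjoint (arrivedBefore A t)) := by
  intro J K hJK
  refine disjoint_left.2 fun ω hJ hK => hJK (Finset.ext fun i => ?_)
  exact (mem_iInter.1 hJ i).symm.trans (mem_iInter.1 hK i)

end Deterministic

/-! ### The expected good objective given no stop before x -/

section Poisson

variable [MeasurableSpace Ω] {P : Measure Ω} {A : Fin n → Ω → Set ℝ} {r : Fin n → ℝ → ℝ≥0}

/-- The event factorises over boxes, and within a box the counts before t and on [t, s) are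
independent, so the past J splits off from the void probability of [t, s). -/
theorem IsPoissonArrivals.le_measure_inter_le_firstArrivalFrom
    (h : IsPoissonArrivals P A r) (hr : ∀ i, Measurable (r i))
    (hbound : ∀ τ : ℝ, 0 < τ → ∑ i, (r i τ : ℝ) ≤ 2 / τ) {t s : ℝ} (ht : 0 < t) (hts : t ≤ s)
    (J : Finset (Fin n)) :
    ENNReal.ofReal ((t / s) ^ 2) * P (arrivedBefore A t J) ≤
      P (arrivedBefore A t J ∩ {ω | ENNReal.ofReal s ≤ firstArrivalFrom A t ω}) := by
  have hE : ∀ i, MeasurableSet[sigmaAlg (A i)] {ω | count (A i) (Iio t) ω ≠ 0 ↔ i ∈ J} :=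
    fun i => @measurableSet_count_ne_zero_iff Ω (sigmaAlg (A i)) _ _
      (measurable_count_sigmaAlg (A i) measurableSet_Iio) _
  have hN : ∀ i, MeasurableSet[sigmaAlg (A i)] {ω | count (A i) (Ico t s) ω = 0} := fun i =>
    measurable_count_sigmaAlg (A i) measurableSet_Ico (measurableSet_singleton 0)
  have hset : arrivedBefore A t J ∩ {ω | ENNReal.ofReal s ≤ firstArrivalFrom A t ω} =
      ⋂ i, ({ω | count (A i) (Iio t) ω ≠ 0 ↔ i ∈ J} ∩ {ω | count (A i) (Ico t s) ω = 0}) := by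
    ext ω
    simp only [arrivedBefore, mem_inter_iff, mem_iInter, mem_ofPred_eq,
      ofReal_le_firstArrivalFrom_iff (ht.trans_le hts), forall_and]
  have hind : ∀ i, P ({ω | count (A i) (Iio t) ω ≠ 0 ↔ i ∈ J} ∩
      {ω | count (A i) (Ico t s) ω = 0}) = P {ω | count (A i) (Iio t) ω ≠ 0 ↔ i ∈ J} *
        P {ω | count (A i) (Ico t s) ω = 0} := by
    intro i
    refine ((h.poisson i).indepFun_count measurableSet_Iio measurableSet_Ico
      (disjoint_left.2 fun x hx hx' => not_le.2 hx hx'.1)).meas_inter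
      ⟨{k | k ≠ 0 ↔ i ∈ J}, ?_, rfl⟩ ⟨{0}, measurableSet_singleton 0, rfl⟩
    exact .of_discrete
  rw [hset, h.indep.meas_iInter fun i => (hE i).inter (hN i), arrivedBefore,
    h.indep.meas_iInter hE]
  simp_rw [hind]
  rw [Finset.prod_mul_distrib, mul_comm]
  gcongr
  exact h.le_prod_measure_count_Ico hr hbound ht hts

/-- Follows from the non-strict bound at u as u decreases to s. The strict form is the one needed
for the layer-cake formula and for the event S > d. -/
theorem IsPoissonArrivals.le_measure_inter_lt_firstArrivalFrom [IsProbabilityMeasure P]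
    (h : IsPoissonArrivals P A r) (hr : ∀ i, Measurable (r i))
    (hbound : ∀ τ : ℝ, 0 < τ → ∑ i, (r i τ : ℝ) ≤ 2 / τ) {t s : ℝ} (ht : 0 < t) (hts : t ≤ s)
    (J : Finset (Fin n)) :
    ENNReal.ofReal ((t / s) ^ 2) * P (arrivedBefore A t J) ≤
      P (arrivedBefore A t J ∩ {ω | ENNReal.ofReal s < firstArrivalFrom A t ω}) := by
  have hs := ht.trans_le hts
  have hlim : Filter.Tendsto (fun u => ENNReal.ofReal ((t / u) ^ 2) * P (arrivedBefore A t J))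
      (nhdsWithin s (Ioi s))
      (nhds (ENNReal.ofReal ((t / s) ^ 2) * P (arrivedBefore A t J))) := by
    refine ENNReal.Tendsto.mul_const ?_ (Or.inr (measure_ne_top _ _))
    refine ENNReal.tendsto_ofReal (Filter.Tendsto.mono_left ?_ nhdsWithin_le_nhds)
    exact (tendsto_const_nhds.div Filter.tendsto_id hs.ne').pow 2
  refine le_of_tendsto hlim (eventually_nhdsWithin_of_forall fun u hu => ?_)
  have hu : s < u := hu
  refine (h.le_measure_inter_le_firstArrivalFrom hr hbound ht (hts.trans hu.le) J).trans ?_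
  refine measure_mono (inter_subset_inter_right _ fun ω hω => ?_)
  exact lt_of_lt_of_le ((ENNReal.ofReal_lt_ofReal_iff (hs.trans hu)).2 hu) hω

theorem lintegral_Ico_div_sq {t d : ℝ} (ht : 0 < t) (htd : t ≤ d) :
    ∫⁻ u in Ico t d, ENNReal.ofReal ((t / u) ^ 2) = ENNReal.ofReal (t - t ^ 2 / d) := by
  have h0 : (0 : ℝ) ∉ uIcc t d := by
    rw [uIcc_of_le htd]
    exact fun h => not_lt.2 h.1 ht
  have heq : (fun u : ℝ => (t / u) ^ 2) = fun u => t ^ 2 * u ^ (-2 : ℤ) := by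
    funext u
    rw [div_pow, div_eq_mul_inv, zpow_neg]
    rfl
  have hval : ∫ u in t..d, (t / u) ^ 2 = t - t ^ 2 / d := by
    rw [heq, intervalIntegral.integral_const_mul, integral_zpow (Or.inr ⟨by norm_num, h0⟩)]
    have hd := ht.trans_le htd
    norm_num
    field_simp
    ring
  have hint : IntervalIntegrable (fun u : ℝ => (t / u) ^ 2) volume t d := by
    rw [heq]
    exact (intervalIntegral.intervalIntegrable_zpow (Or.inr h0)).const_mul _
  rw [← hval, intervalIntegral.integral_of_le htd, ofReal_integral_eq_lintegral_ofReal hint.1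
    (ae_of_all _ fun u => sq_nonneg _), restrict_Ico_eq_restrict_Ioc]

/-- Layer-cake formula: levels below t contribute t since S ≥ t always, and levels u in [t, d)
contribute at least ∫ (t/u)² du = t - t²/d. -/
theorem IsPoissonArrivals.le_setLIntegral_min_firstArrivalFrom [IsProbabilityMeasure P]
    (h : IsPoissonArrivals P A r) (hr : ∀ i, Measurable (r i))
    (hbound : ∀ τ : ℝ, 0 < τ → ∑ i, (r i τ : ℝ) ≤ 2 / τ) {t d : ℝ} (ht : 0 < t) (htd : t ≤ d)
    (J : Finset (Fin n)) :
    ENNReal.ofReal (2 * t - t ^ 2 / d) * P (arrivedBefore A t J) ≤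
      ∫⁻ ω in arrivedBefore A t J, min (firstArrivalFrom A t ω) (ENNReal.ofReal d) ∂P := by
  have hS : Measurable (firstArrivalFrom A t) :=
    measurable_firstArrivalFrom (fun i => (h.poisson i).measurable_count) t
  have hEm : MeasurableSet (arrivedBefore A t J) :=
    measurableSet_arrivedBefore (fun i => (h.poisson i).measurable_count) t J
  set E := arrivedBefore A t J
  have hd := ht.trans_le htd
  have hfin : ∀ ω, min (firstArrivalFrom A t ω) (ENNReal.ofReal d) ≠ ∞ := fun ω =>
    ne_top_of_le_ne_top ENNReal.ofReal_ne_top (min_le_right _ _)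
  have hcake := lintegral_eq_lintegral_meas_lt (P.restrict E)
    (f := fun ω => (min (firstArrivalFrom A t ω) (ENNReal.ofReal d)).toReal)
    (ae_of_all _ fun ω => ENNReal.toReal_nonneg)
    (hS.min measurable_const).ennreal_toReal.aemeasurable
  simp only [ENNReal.ofReal_toReal (hfin _)] at hcake
  rw [hcake]
  have hlt : ∀ u : ℝ, 0 < u → u < d → {ω | u < (min (firstArrivalFrom A t ω)
      (ENNReal.ofReal d)).toReal} = {ω | ENNReal.ofReal u < firstArrivalFrom A t ω} := by
    intro u hu hud
    ext ω
    simp only [mem_ofPred_eq]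
    rw [← ENNReal.ofReal_lt_iff_lt_toReal hu.le (hfin ω), lt_min_iff]
    exact and_iff_left ((ENNReal.ofReal_lt_ofReal_iff hd).2 hud)
  have hSm : ∀ u : ℝ, MeasurableSet {ω | ENNReal.ofReal u < firstArrivalFrom A t ω} :=
    fun u => measurableSet_lt measurable_const hS
  have hsub : Ioo 0 t ∪ Ico t d ⊆ Ioi 0 := union_subset (fun u hu => hu.1)
    fun u hu => ht.trans_le hu.1
  have hdisj : Disjoint (Ioo 0 t) (Ico t d) :=
    disjoint_left.2 fun u hu hu' => not_le.2 hu.2 hu'.1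
  -- Levels from d on are discarded; min(S, d) never exceeds them.
  refine le_trans ?_ (lintegral_mono_set hsub)
  rw [lintegral_union measurableSet_Ico hdisj]
  have h1 : ENNReal.ofReal t * P E ≤ ∫⁻ u in Ioo 0 t, P.restrict E {ω | u <
      (min (firstArrivalFrom A t ω) (ENNReal.ofReal d)).toReal} := by
    have : ENNReal.ofReal t * P E = ∫⁻ u in Ioo 0 t, P E := by
      rw [setLIntegral_const, Real.volume_Ioo, sub_zero, mul_comm]
    rw [this]
    refine setLIntegral_mono' measurableSet_Ioo fun u hu => ?_
    rw [hlt u hu.1 (hu.2.trans_le htd)]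
    have : {ω | ENNReal.ofReal u < firstArrivalFrom A t ω} = univ :=
      eq_univ_of_forall fun ω => lt_of_lt_of_le ((ENNReal.ofReal_lt_ofReal_iff ht).2 hu.2)
        ((ofReal_le_firstArrivalFrom_iff ht).2 fun i => by simp [count])
    rw [this, Measure.restrict_apply_univ]
  have h2 : ENNReal.ofReal (t - t ^ 2 / d) * P E ≤ ∫⁻ u in Ico t d, P.restrict E {ω | u <
      (min (firstArrivalFrom A t ω) (ENNReal.ofReal d)).toReal} := by
    rw [← lintegral_Ico_div_sq ht htd, ← lintegral_mul_const _ (by fun_prop)]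
    refine setLIntegral_mono' measurableSet_Ico fun u hu => ?_
    rw [hlt u (ht.trans_le hu.1) hu.2, Measure.restrict_apply (hSm u), inter_comm]
    exact h.le_measure_inter_lt_firstArrivalFrom hr hbound ht hu.1 J
  have hnn : 0 ≤ t - t ^ 2 / d := by
    rw [sub_nonneg, div_le_iff₀ hd, sq]
    gcongr
  rw [show 2 * t - t ^ 2 / d = t + (t - t ^ 2 / d) by ring, ENNReal.ofReal_add ht.le hnn, add_mul]
  exact add_le_add h1 h2

/-- The deficit t²/d in the mean of min(S, d) is exactly compensated by the balanced time d,
collected with probability at least (t/d)². -/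
theorem IsPoissonArrivals.le_setLIntegral_minObjective_of_arrivedBefore [IsProbabilityMeasure P]
    (h : IsPoissonArrivals P A r) (hr : ∀ i, Measurable (r i))
    (hbound : ∀ τ : ℝ, 0 < τ → ∑ i, (r i τ : ℝ) ≤ 2 / τ) (c v : Fin n → ℝ≥0)
    {t : ℝ} (ht : 0 < t) {J : Finset (Fin n)} (hJ : ∀ i ∈ J, t ≤ balancedTime c v i) :
    ENNReal.ofReal (2 * t) * P (arrivedBefore A t J) ≤
      ∫⁻ ω in arrivedBefore A t J, minObjective c v A ω ∂P := by
  have hEm : MeasurableSet (arrivedBefore A t J) :=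
    measurableSet_arrivedBefore (fun i => (h.poisson i).measurable_count) t J
  have hS : Measurable (firstArrivalFrom A t) :=
    measurable_firstArrivalFrom (fun i => (h.poisson i).measurable_count) t
  rcases J.eq_empty_or_nonempty with rfl | hne
  -- With no earlier box there is no finite d: the stopping time dominates S, hence min(S, d) for
  -- every d, and d tends to infinity.
  · have hlim : Filter.Tendsto
        (fun d => ENNReal.ofReal (2 * t - t ^ 2 / d) * P (arrivedBefore A t ∅)) Filter.atTop
        (nhds (ENNReal.ofReal (2 * t - 0) * P (arrivedBefore A t ∅))) := by
      refine ENNReal.Tendsto.mul_const ?_ (Or.inr (measure_ne_top _ _))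
      exact ENNReal.tendsto_ofReal
        (tendsto_const_nhds.sub (tendsto_const_nhds.div_atTop Filter.tendsto_id))
    rw [sub_zero] at hlim
    refine le_of_tendsto hlim ((Filter.eventually_ge_atTop t).mono fun d htd => ?_)
    refine (h.le_setLIntegral_min_firstArrivalFrom hr hbound ht htd ∅).trans ?_
    refine setLIntegral_mono' hEm fun ω hω => ?_
    exact (min_firstArrivalFrom_le_stoppingTime hω (by simp)).trans
      (stoppingTime_le_minObjective c v A ω)
  · obtain ⟨j, hj, hmin⟩ := J.exists_min_image (balancedTime c v) hne
    have htd := hJ j hj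
    set d := balancedTime c v j with hd_def
    have hd0 := ht.trans_le htd
    have hcoe : (d : ℝ≥0∞) = ENNReal.ofReal d := (ENNReal.ofReal_coe_nnreal).symm
    have hle : ∫⁻ ω in arrivedBefore A t J, (min (firstArrivalFrom A t ω) d +
        {ω | (d : ℝ≥0∞) < firstArrivalFrom A t ω}.indicator (fun _ => (d : ℝ≥0∞)) ω) ∂P ≤
          ∫⁻ ω in arrivedBefore A t J, minObjective c v A ω ∂P :=
      setLIntegral_mono' hEm fun ω hω => min_add_indicator_le_minObjective ht hω hj
        (by rw [← hd_def, hcoe]; exact ENNReal.ofReal_le_ofReal htd) hmin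
    refine le_trans ?_ hle
    have hSm : MeasurableSet {ω | (d : ℝ≥0∞) < firstArrivalFrom A t ω} :=
      measurableSet_lt measurable_const hS
    rw [lintegral_add_left (hS.min measurable_const), lintegral_indicator_const hSm,
      Measure.restrict_apply hSm, inter_comm, hcoe]
    have h1 := h.le_setLIntegral_min_firstArrivalFrom hr hbound ht htd J
    have h2 := h.le_measure_inter_lt_firstArrivalFrom hr hbound ht htd J
    have hnn : 0 ≤ 2 * t - t ^ 2 / d := by
      rw [sub_nonneg, div_le_iff₀ hd0, sq]
      nlinarith
    calc ENNReal.ofReal (2 * t) * P (arrivedBefore A t J)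
        = ENNReal.ofReal (2 * t - t ^ 2 / d) * P (arrivedBefore A t J) +
          ENNReal.ofReal d * (ENNReal.ofReal ((t / d) ^ 2) * P (arrivedBefore A t J)) := by
          rw [← mul_assoc, ← ENNReal.ofReal_mul hd0.le, ← add_mul,
            ← ENNReal.ofReal_add hnn (by positivity)]
          congr 2
          field_simp
          ring
      _ ≤ _ := by gcongr

/-- For finite positive x the event is cut along the set J of boxes that arrived before x, on each
of which the previous bound applies. -/
theorem IsPoissonArrivals.two_mul_le_setLIntegral_minObjective [IsProbabilityMeasure P]
    (h : IsPoissonArrivals P A r) (hr : ∀ i, Measurable (r i))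
    (hbound : ∀ τ : ℝ, 0 < τ → ∑ i, (r i τ : ℝ) ≤ 2 / τ) (c v : Fin n → ℝ≥0) (x : ℝ≥0∞) :
    2 * x * P {ω | x ≤ stoppingTime c v A ω} ≤
      ∫⁻ ω in {ω | x ≤ stoppingTime c v A ω}, minObjective c v A ω ∂P := by
  have hT : Measurable (stoppingTime c v A) :=
    measurable_stoppingTime c v fun i => (h.poisson i).measurable_count
  have hTm : MeasurableSet {ω | x ≤ stoppingTime c v A ω} := measurableSet_le measurable_const hT
  rcases eq_or_ne x 0 with rfl | h0
  · simp
  rcases eq_or_ne x ∞ with rfl | htop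
  · rw [ENNReal.mul_top two_ne_zero, ← setLIntegral_const]
    exact setLIntegral_mono' hTm fun ω hω =>
      le_trans hω (stoppingTime_le_minObjective c v A ω)
  obtain ⟨t, ht, rfl⟩ : ∃ t : ℝ, 0 < t ∧ x = ENNReal.ofReal t :=
    ⟨x.toReal, ENNReal.toReal_pos h0 htop, (ENNReal.ofReal_toReal htop).symm⟩
  have hEm : ∀ J, MeasurableSet
      (arrivedBefore A t J ∩ {ω | ENNReal.ofReal t ≤ stoppingTime c v A ω}) := fun J =>
    (measurableSet_arrivedBefore (fun i => (h.poisson i).measurable_count) t J).inter hTm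
  have hdisj : Pairwise (Function.onFun Disjoint fun J =>
      arrivedBefore A t J ∩ {ω | ENNReal.ofReal t ≤ stoppingTime c v A ω}) := fun J K hJK =>
    (pairwise_disjoint_arrivedBefore A t hJK).mono inter_subset_left inter_subset_left
  have hU : {ω | ENNReal.ofReal t ≤ stoppingTime c v A ω} =
      ⋃ J, arrivedBefore A t J ∩ {ω | ENNReal.ofReal t ≤ stoppingTime c v A ω} := by
    rw [← iUnion_inter, iUnion_arrivedBefore, univ_inter]
  rw [hU, lintegral_iUnion hEm hdisj, measure_iUnion hdisj hEm, ← ENNReal.tsum_mul_left]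
  refine ENNReal.tsum_le_tsum fun J => ?_
  -- For a given J, the condition T ≥ t either holds automatically or is impossible: a box in J with
  -- balanced time below t could already have been taken.
  by_cases hJ : ∀ i ∈ J, t ≤ balancedTime c v i
  · have hsub : arrivedBefore A t J ⊆ {ω | ENNReal.ofReal t ≤ stoppingTime c v A ω} := by
      intro ω hω
      refine le_trans (le_min ?_ le_rfl) (min_firstArrivalFrom_le_stoppingTime hω
        (d := ENNReal.ofReal t) fun i hi => ENNReal.ofReal_le_coe.2 (hJ i hi))
      exact (ofReal_le_firstArrivalFrom_iff ht).2 fun i => by simp [count]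
    rw [inter_eq_left.2 hsub]
    have := h.le_setLIntegral_minObjective_of_arrivedBefore hr hbound c v ht hJ
    rwa [ENNReal.ofReal_mul zero_le_two, ENNReal.ofReal_ofNat] at this
  · push Not at hJ
    obtain ⟨i, hi, hlt⟩ := hJ
    have hemp : arrivedBefore A t J ∩ {ω | ENNReal.ofReal t ≤ stoppingTime c v A ω} = ∅ := by
      refine eq_empty_of_forall_notMem fun ω ⟨hω, hle⟩ => ?_
      have hle' : ENNReal.ofReal t ≤ takeTime c v A i ω := le_trans hle (iInf_le _ i)
      refine absurd hle' (not_le.2 (max_lt ?_ ?_))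
      · exact arrivalTime_lt_of_mem ht hω hi
      · rw [← ENNReal.ofReal_coe_nnreal]
        exact (ENNReal.ofReal_lt_ofReal_iff ht).2 hlt
    simp [hemp]

end Poisson

/-! ### Superposition of good and bad arrivals -/

theorem arrivalTime_superpose (A B : Fin n → Ω → Set ℝ) (i : Fin n) (ω : Ω) :
    arrivalTime (superpose A B) i ω = min (arrivalTime A i ω) (arrivalTime B i ω) :=
  iInf_union

theorem takeTime_superpose (c v : Fin n → ℝ≥0) (A B : Fin n → Ω → Set ℝ) (i : Fin n) (ω : Ω) :
    takeTime c v (superpose A B) i ω = min (takeTime c v A i ω) (takeTime c v B i ω) := by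
  rw [takeTime, arrivalTime_superpose, max_min_distrib_right]
  rfl

theorem stoppingTime_superpose (c v : Fin n → ℝ≥0) (A B : Fin n → Ω → Set ℝ) (ω : Ω) :
    stoppingTime c v (superpose A B) ω = min (stoppingTime c v A ω) (stoppingTime c v B ω) := by
  simp only [stoppingTime, takeTime_superpose]
  exact iInf_inf_eq

/-! ### Ties, and freezing the bad stopping time -/

section Poisson

variable [MeasurableSpace Ω] {P : Measure Ω} {A : Fin n → Ω → Set ℝ} {r : Fin n → ℝ → ℝ≥0}

theorem IsPoissonArrivals.indepFun_arrivalTime (h : IsPoissonArrivals P A r) {i j : Fin n}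
    (hij : i ≠ j) : IndepFun (arrivalTime A i) (arrivalTime A j) P := by
  rw [IndepFun_iff_Indep]
  have hle : ∀ i, MeasurableSpace.comap (arrivalTime A i) inferInstance ≤ sigmaAlg (A i) :=
    fun i => (@measurable_arrivalTime Ω n (sigmaAlg (A i)) A i fun _ hB =>
      measurable_count_sigmaAlg (A i) hB).comap_le
  exact indep_of_indep_of_le (h.indep.indep hij) (hle i) (hle j)

/-- Arrival times of different boxes almost surely do not coincide in `(0, ∞)`. -/
theorem IsPoissonArrivals.ae_arrivalTime_ne [IsProbabilityMeasure P]
    (h : IsPoissonArrivals P A r) (hr : ∀ i, Measurable (r i))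
    (hbound : ∀ τ : ℝ, 0 < τ → ∑ i, (r i τ : ℝ) ≤ 2 / τ) {i j : Fin n} (hij : i ≠ j) :
    ∀ᵐ ω ∂P, arrivalTime A i ω = arrivalTime A j ω →
      arrivalTime A i ω = 0 ∨ arrivalTime A i ω = ∞ := by
  have hm : ∀ i, Measurable (arrivalTime A i) := fun i =>
    measurable_arrivalTime (h.poisson i).measurable_count
  have hprod := (indepFun_iff_map_prod_eq_prod_map_map (hm j).aemeasurable
    (hm i).aemeasurable).1 (h.indepFun_arrivalTime hij.symm)
  set s : Set (ℝ≥0∞ × ℝ≥0∞) := {p | p.2 = p.1 ∧ p.2 ≠ 0 ∧ p.2 ≠ ∞}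
  have hs : MeasurableSet s := (measurableSet_eq_fun measurable_snd measurable_fst).inter
    (((measurableSet_singleton 0).compl.preimage measurable_snd).inter
      ((measurableSet_singleton ∞).compl.preimage measurable_snd))
  have hnull : P ((fun ω => (arrivalTime A j ω, arrivalTime A i ω)) ⁻¹' s) = 0 := by
    rw [← Measure.map_apply ((hm j).prodMk (hm i)) hs, hprod, Measure.measure_prod_null hs]
    -- By independence the arrival time of box j can be frozen at x, and the arrival time of box i
    -- has no atom at x in (0, ∞).
    refine ae_of_all _ fun x => ?_
    simp only [Pi.zero_apply]
    rw [Measure.map_apply (hm i) (hs.preimage measurable_prodMk_left)]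
    by_cases hx : x ≠ 0 ∧ x ≠ ∞
    · refine measure_mono_null (fun ω hω => ?_)
        (h.measure_arrivalTime_eq hr hbound hx.1 hx.2 i)
      exact hω.1
    · convert measure_empty (μ := P)
      refine eq_empty_of_forall_notMem fun ω hω => hx ?_
      obtain ⟨h1, h2⟩ := hω
      simp only at h1 h2
      rwa [h1] at h2
  filter_upwards [measure_eq_zero_iff_ae_notMem.1 hnull] with ω hω heq
  by_contra! hcon
  exact hω ⟨heq, hcon.1, hcon.2⟩

/-- Almost surely, all boxes that attain a finite stopping time have the same balanced time. -/
theorem IsPoissonArrivals.ae_balancedTime_eq [IsProbabilityMeasure P]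
    (h : IsPoissonArrivals P A r) (hr : ∀ i, Measurable (r i))
    (hbound : ∀ τ : ℝ, 0 < τ → ∑ i, (r i τ : ℝ) ≤ 2 / τ) (c v : Fin n → ℝ≥0) :
    ∀ᵐ ω ∂P, ∀ i j, takeTime c v A i ω = takeTime c v A j ω → takeTime c v A i ω ≠ ∞ →
      balancedTime c v i = balancedTime c v j := by
  have h1 : ∀ᵐ ω ∂P, ∀ i j, arrivalTime A i ω = balancedTime c v j → balancedTime c v j = 0 := by
    refine ae_all_iff.2 fun i => ae_all_iff.2 fun j => ?_
    by_cases hj : balancedTime c v j = 0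
    · exact ae_of_all _ fun _ _ => hj
    · have := h.measure_arrivalTime_eq hr hbound (x := balancedTime c v j) (by simpa using hj)
        ENNReal.coe_ne_top i
      filter_upwards [measure_eq_zero_iff_ae_notMem.1 this] with ω hω heq
      exact absurd heq hω
  have h2 : ∀ᵐ ω ∂P, ∀ i j, i ≠ j → arrivalTime A i ω = arrivalTime A j ω →
      arrivalTime A i ω = 0 ∨ arrivalTime A i ω = ∞ :=
    ae_all_iff.2 fun i => ae_all_iff.2 fun j =>
      Filter.eventually_imp_distrib_left.2 fun hij => h.ae_arrivalTime_ne hr hbound hij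
  filter_upwards [h1, h2] with ω hω1 hω2
  -- In a tie with unequal balanced times, the box i with the smaller one is taken at its arrival
  -- time, as its take time is at least that of j's balanced time. This arrival then coincides with
  -- the arrival or with the balanced time of j, both null events at positive finite times.
  have key : ∀ i j, takeTime c v A i ω = takeTime c v A j ω → takeTime c v A i ω ≠ ∞ →
      ¬ balancedTime c v i < balancedTime c v j := by
    intro i j heq htop hlt
    have hpos : (0 : ℝ≥0∞) < balancedTime c v j := by exact_mod_cast zero_le.trans_lt hlt
    have hge : (balancedTime c v j : ℝ≥0∞) ≤ takeTime c v A i ω := by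
      rw [heq]
      exact le_max_right _ _
    have hi : takeTime c v A i ω = arrivalTime A i ω := by
      refine max_eq_left (le_of_not_gt fun hcon => ?_)
      rw [takeTime, max_eq_right hcon.le] at hge
      exact absurd hge (not_le.2 (by exact_mod_cast hlt))
    rw [hi] at heq htop hge
    rcases max_choice (arrivalTime A j ω) (balancedTime c v j) with hj | hj
    · rw [takeTime, hj] at heq
      rcases hω2 i j (fun hij => by simp [hij] at hlt) heq with h0 | h0
      · exact absurd (h0 ▸ hge) (not_le.2 hpos)
      · exact htop h0
    · rw [takeTime, hj] at heq
      exact hpos.ne' (by exact_mod_cast hω1 i j heq)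
  intro i j heq htop
  exact le_antisymm (not_lt.1 (key j i heq.symm (heq ▸ htop))) (not_lt.1 (key i j heq htop))

/-- By Fubini, U may be replaced by a constant u, for which the claim is the hypothesis at x = u.
Only U has to be independent of the pair; T and M may depend on each other. -/
theorem lintegral_indicator_le_of_indepFun [IsProbabilityMeasure P] {T M U : Ω → ℝ≥0∞}
    (hT : Measurable T) (hM : Measurable M) (hU : Measurable U)
    (hind : IndepFun (fun ω => (T ω, M ω)) U P)
    (h : ∀ x, 2 * x * P {ω | x ≤ T ω} ≤ ∫⁻ ω in {ω | x ≤ T ω}, M ω ∂P) :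
    ∫⁻ ω, {ω | U ω ≤ T ω}.indicator (fun ω => 2 * U ω) ω ∂P ≤
      ∫⁻ ω, {ω | U ω ≤ T ω}.indicator M ω ∂P := by
  have hTM := hT.prodMk hM
  have hprod := (indepFun_iff_map_prod_eq_prod_map_map hTM.aemeasurable hU.aemeasurable).1 hind
  have key : ∀ F : (ℝ≥0∞ × ℝ≥0∞) × ℝ≥0∞ → ℝ≥0∞, Measurable F →
      ∫⁻ ω, F ((T ω, M ω), U ω) ∂P = ∫⁻ u, ∫⁻ ω, F ((T ω, M ω), u) ∂P ∂(P.map U) := by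
    intro F hF
    rw [← lintegral_map hF (hTM.prodMk hU), hprod, lintegral_prod_symm' _ hF]
    refine lintegral_congr fun u => ?_
    exact lintegral_map (hF.comp measurable_prodMk_right) hTM
  have hs : MeasurableSet {p : (ℝ≥0∞ × ℝ≥0∞) × ℝ≥0∞ | p.2 ≤ p.1.1} :=
    measurableSet_le (by fun_prop) (by fun_prop)
  have k1 : ∫⁻ ω, {ω | U ω ≤ T ω}.indicator (fun ω => 2 * U ω) ω ∂P =
      ∫⁻ u, ∫⁻ ω, {ω | u ≤ T ω}.indicator (fun _ => 2 * u) ω ∂P ∂(P.map U) :=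
    key ({p | p.2 ≤ p.1.1}.indicator fun p => 2 * p.2) (Measurable.indicator (by fun_prop) hs)
  have k2 : ∫⁻ ω, {ω | U ω ≤ T ω}.indicator M ω ∂P =
      ∫⁻ u, ∫⁻ ω, {ω | u ≤ T ω}.indicator M ω ∂P ∂(P.map U) :=
    key (indicator {p : (ℝ≥0∞ × ℝ≥0∞) × ℝ≥0∞ | p.2 ≤ p.1.1} fun p => p.1.2)
      (Measurable.indicator (by fun_prop) hs)
  rw [k1, k2]
  refine lintegral_mono fun u => ?_
  have hu : MeasurableSet {ω | u ≤ T ω} := measurableSet_le measurable_const hT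
  simp only [lintegral_indicator hu, setLIntegral_const]
  exact h u

end Poisson

/-- If the bad process stops no later, the balanced time is bounded by the stopping time, whence the
factor 2. Otherwise the taken box attains the good minimum, and equal balanced times among tied
boxes identify its cost with the smallest one. -/
theorem objective_superpose_le {c v : Fin n → ℝ≥0} {A B : Fin n → Ω → Set ℝ} {I : Ω → Fin n}
    {ω : Ω} (hI : takeTime c v (superpose A B) (I ω) ω = stoppingTime c v (superpose A B) ω)
    (hties : ∀ i j, takeTime c v A i ω = takeTime c v A j ω → takeTime c v A i ω ≠ ∞ →
      balancedTime c v i = balancedTime c v j) :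
    objective c v (superpose A B) I ω ≤
      {ω | stoppingTime c v B ω ≤ stoppingTime c v A ω}.indicator
        (fun ω => 2 * stoppingTime c v B ω) ω +
      {ω | stoppingTime c v B ω ≤ stoppingTime c v A ω}ᶜ.indicator (minObjective c v A) ω := by
  by_cases hω : stoppingTime c v B ω ≤ stoppingTime c v A ω
  · rw [indicator_of_mem (by exact hω), indicator_of_notMem (by exact fun h => h hω), add_zero,
      two_mul, objective]
    have hβ : (balancedTime c v (I ω) : ℝ≥0∞) ≤ stoppingTime c v (superpose A B) ω := by
      rw [← hI]
      exact le_max_right _ _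
    rw [stoppingTime_superpose, min_eq_right hω] at *
    gcongr
  · rw [indicator_of_notMem (by exact hω), indicator_of_mem (by exact hω), zero_add, objective]
    have hlt := not_le.1 hω
    rw [stoppingTime_superpose, min_eq_left hlt.le] at *
    have hA : takeTime c v A (I ω) ω = stoppingTime c v A ω := by
      rw [takeTime_superpose] at hI
      rcases min_choice (takeTime c v A (I ω) ω) (takeTime c v B (I ω) ω) with h | h
      · rwa [h] at hI
      · rw [h] at hI
        exact absurd (hI ▸ iInf_le (fun i => takeTime c v B i ω) (I ω)) (not_le.2 hlt)
    refine le_minObjective fun i hi => ?_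
    -- The good stopping time is finite here, being strictly below the bad one, so the tie condition
    -- applies.
    rw [hties (I ω) i (hA.trans hi.symm) (hA ▸ hlt.ne_top)]

end BalancedStopping

open BalancedStopping in
theorem mainTheorem3 {Ω : Type*} [MeasurableSpace Ω] (P : Measure Ω) [IsProbabilityMeasure P]
    {n : ℕ} (c v : Fin n → ℝ≥0)
    (rg rb : Fin n → ℝ → ℝ≥0)
    (hrg : ∀ i, Measurable (rg i)) (hrb : ∀ i, Measurable (rb i))
    (hbound : ∀ τ : ℝ, 0 < τ → ∑ i, (rg i τ : ℝ) ≤ 2 / τ)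
    (G B : Fin n → Ω → Set ℝ)
    (hG : BalancedStopping.IsPoissonArrivals P G rg)
    (hB : BalancedStopping.IsPoissonArrivals P B rb)
    (hGB : Indep (BalancedStopping.sigmaAlgFamily G) (BalancedStopping.sigmaAlgFamily B) P)
    (Ig Igb : Ω → Fin n)
    (hIg : BalancedStopping.IsTakenBox c v G Ig)
    (hIgb : BalancedStopping.IsTakenBox c v (BalancedStopping.superpose G B) Igb) :
    ∫⁻ ω, BalancedStopping.objective c v (BalancedStopping.superpose G B) Igb ω ∂P ≤
      ∫⁻ ω, BalancedStopping.objective c v G Ig ω ∂P := by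
  have hcG := fun i => (hG.poisson i).measurable_count
  have hcB := fun i => (hB.poisson i).measurable_count
  have hT : Measurable (stoppingTime c v G) := measurable_stoppingTime c v hcG
  have hU : Measurable (stoppingTime c v B) := measurable_stoppingTime c v hcB
  have hM : Measurable (minObjective c v G) := measurable_minObjective c v hcG
  have hind : IndepFun (fun ω => (stoppingTime c v G ω, minObjective c v G ω))
      (stoppingTime c v B) P := by
    rw [IndepFun_iff_Indep]
    have hG' := fun i B hB => measurable_count_sigmaAlgFamily G i (B := B) hB
    have hB' := fun i C hC => measurable_count_sigmaAlgFamily B i (B := C) hC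
    refine indep_of_indep_of_le hGB (Measurable.comap_le ?_) (Measurable.comap_le ?_)
    · exact @Measurable.prodMk _ (sigmaAlgFamily G) _ _ _ _ _ _
        (@measurable_stoppingTime _ _ (sigmaAlgFamily G) _ c v hG')
        (@measurable_minObjective _ _ (sigmaAlgFamily G) _ c v hG')
    · exact @measurable_stoppingTime _ _ (sigmaAlgFamily B) _ c v hB'
  have hs : MeasurableSet {ω | stoppingTime c v B ω ≤ stoppingTime c v G ω} :=
    measurableSet_le hU hT
  calc ∫⁻ ω, objective c v (superpose G B) Igb ω ∂P
      ≤ ∫⁻ ω, ({ω | stoppingTime c v B ω ≤ stoppingTime c v G ω}.indicator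
          (fun ω => 2 * stoppingTime c v B ω) ω +
        {ω | stoppingTime c v B ω ≤ stoppingTime c v G ω}ᶜ.indicator
          (minObjective c v G) ω) ∂P := by
        refine lintegral_mono_ae ?_
        filter_upwards [hG.ae_balancedTime_eq hrg hbound c v] with ω hω
        exact objective_superpose_le (hIgb.argmin ω) hω
    -- Only the part where the bad process stops no later needs an estimate; elsewhere the
    -- integrands agree.
    _ ≤ ∫⁻ ω, {ω | stoppingTime c v B ω ≤ stoppingTime c v G ω}.indicator
          (minObjective c v G) ω ∂P +
        ∫⁻ ω, {ω | stoppingTime c v B ω ≤ stoppingTime c v G ω}ᶜ.indicator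
          (minObjective c v G) ω ∂P := by
        rw [lintegral_add_right _ (hM.indicator hs.compl)]
        gcongr 1
        exact lintegral_indicator_le_of_indepFun hT hM hU hind
          (hG.two_mul_le_setLIntegral_minObjective hrg hbound c v)
    _ = ∫⁻ ω, minObjective c v G ω ∂P := by
        rw [lintegral_indicator hs, lintegral_indicator hs.compl, lintegral_add_compl _ hs]
    _ ≤ ∫⁻ ω, objective c v G Ig ω ∂P :=
        lintegral_mono fun ω => minObjective_le c v G (hIg.argmin ω)
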